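/- Let $(\Omega,\mathscr F,P)$ be a probability space and $(E,\rho)$ a complete metric space. Let $L^0(\Omega,E)$ be the space of strongly measurable maps $\Omega\to E$ modulo $P$-a.e. equality, with the topology of convergence in measure, and let $X:[0,\infty)\times E\to L^0(\Omega,E)$ be continuous. Let $C_b(E)$ be the Banach space of bounded continuous functions $E\to\mathbb C$ with the supremum norm, $\mathcal M_0(E)$ the space of bounded complex Radon measures on $E$, and $\sigma$ the weak topology $\sigma(C_b(E),\mathcal M_0(E))$ for the duality $\langle f,\mu\rangle=\int_E f\,d\mu$. The strict topology $\beta_0$ on $C_b(E)$ is the locally convex topology generated by the seminorms $p_\varphi(f)=\|\varphi f\|_\infty$, where $\varphi$ runs through the bounded functions on $E$ such that for every $\varepsilon>0$ there is a compact $K\subset E$ with $|\varphi|\le\varepsilon$ off $K$. A set $\mathcal S$ of $\beta_0$-continuous linear operators on $C_b(E)$ is called $\beta_0$-equicontinuous if for every $\beta_0$-continuous seminorm $p$ there is a $\beta_0$-continuous seminorm $q$ with $p(Tf)\le q(f)$ for all $f\in C_b(E)$ and $T\in\mathcal S$. For $t\ge 0$, $f\in C_b(E)$ and $x\in E$ put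 $T(t)f(x)=\mathbb E\, f(X(t,x))$. Then each $T(t)$ is a well-defined $\sigma$-continuous linear operator on $C_b(E)$, and for every $t_0>0$ the set $\{T(t):0\le t\le t_0\}$ is $\beta_0$-equicontinuous. If moreover $T(0)=I$ and $T(t+s)=T(t)T(s)$ for all $t,s\ge 0$, then $(T(t))_{t\ge0}$ is a semigroup on the norming dual pair $(C_b(E),\mathcal M_0(E))$ (that is, it consists of $\sigma$-continuous operators, satisfies the semigroup law, and there are $M\ge1$ and $\omega\in\mathbb R$ with $\|T(t)\|\le Me^{\omega t}$ for all $t\ge0$); it is $\beta_0$-continuous, i.e. $t\mapsto T(t)f$ is $\beta_0$-continuous on $[0,\infty)$ for every $f\in C_b(E)$; and it is quasi-$\beta_0$-equicontinuous, i.e. for some $\alpha\in\mathbb R$ the set $\{e^{-\alpha t}T(t):t\ge0\}$ is $\beta_0$-equicontinuous. -/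

import Mathlib

open Set Filter Topology MeasureTheory
open scoped NNReal ENNReal BoundedContinuousFunction

noncomputable section

/-! ### The space `L⁰(Ω, E)` with the topology of convergence in measure

`Ω →ₘ[P] E` is Mathlib's space of (almost everywhere) strongly measurable maps modulo equality
`P`-almost everywhere. -/

section ConvergenceInMeasure

variable {Ω E : Type*} [MeasurableSpace Ω] {P : Measure Ω} [MetricSpace E]

/-- The basic neighbourhood `{Y : P(ρ(Y, X) ≥ ε) < ε}` of `X` in `L⁰(Ω, E)`. -/
def measureBall (X : Ω →ₘ[P] E) (ε : ℝ) : Set (Ω →ₘ[P] E) :=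
  {Y | P {ω | ε ≤ dist (Y ω) (X ω)} < ENNReal.ofReal ε}

theorem measureBall_mono (X : Ω →ₘ[P] E) {ε δ : ℝ} (h : ε ≤ δ) :
    measureBall X ε ⊆ measureBall X δ := fun _ hY =>
  lt_of_le_of_lt (measure_mono fun _ hω => h.trans hω)
    (lt_of_lt_of_le hY (ENNReal.ofReal_le_ofReal h))

theorem self_mem_measureBall (X : Ω →ₘ[P] E) {ε : ℝ} (h : 0 < ε) : X ∈ measureBall X ε := by
  simp [measureBall, h, h.not_ge]

theorem measureBall_triangle {X Y Z : Ω →ₘ[P] E} {ε : ℝ} (h : 0 < ε)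
    (hY : Y ∈ measureBall X (ε / 2)) (hZ : Z ∈ measureBall Y (ε / 2)) : Z ∈ measureBall X ε := by
  have hsub : {ω | ε ≤ dist (Z ω) (X ω)} ⊆
      {ω | ε / 2 ≤ dist (Z ω) (Y ω)} ∪ {ω | ε / 2 ≤ dist (Y ω) (X ω)} := by
    intro ω hω
    simp only [mem_ofPred_eq, mem_union] at hω ⊢
    by_contra! hc
    linarith [dist_triangle (Z ω) (Y ω) (X ω)]
  calc P {ω | ε ≤ dist (Z ω) (X ω)}
      ≤ P {ω | ε / 2 ≤ dist (Z ω) (Y ω)} + P {ω | ε / 2 ≤ dist (Y ω) (X ω)} :=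
        (measure_mono hsub).trans (measure_union_le _ _)
    _ < ENNReal.ofReal (ε / 2) + ENNReal.ofReal (ε / 2) := ENNReal.add_lt_add hZ hY
    _ = ENNReal.ofReal ε := by
        rw [← ENNReal.ofReal_add (by positivity) (by positivity), add_halves]

/-- The topology of convergence in measure on `L⁰(Ω, E)`. -/
instance convergenceInMeasureTopology : TopologicalSpace (Ω →ₘ[P] E) where
  IsOpen U := ∀ X ∈ U, ∃ ε : ℝ, 0 < ε ∧ measureBall X ε ⊆ U
  isOpen_univ := fun _ _ => ⟨1, one_pos, subset_univ _⟩
  isOpen_inter := by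
    rintro U V hU hV X ⟨hXU, hXV⟩
    obtain ⟨ε, hε, h1⟩ := hU X hXU
    obtain ⟨δ, hδ, h2⟩ := hV X hXV
    exact ⟨min ε δ, lt_min hε hδ, fun Y hY =>
      ⟨h1 (measureBall_mono X (min_le_left _ _) hY),
        h2 (measureBall_mono X (min_le_right _ _) hY)⟩⟩
  isOpen_sUnion := by
    rintro S hS X ⟨U, hU, hX⟩
    obtain ⟨ε, hε, h⟩ := hS U hU X hX
    exact ⟨ε, hε, fun Y hY => ⟨U, hU, h hY⟩⟩

theorem mem_nhds_iff_measureBall {X : Ω →ₘ[P] E} {s : Set (Ω →ₘ[P] E)} :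
    s ∈ 𝓝 X ↔ ∃ ε : ℝ, 0 < ε ∧ measureBall X ε ⊆ s := by
  rw [_root_.mem_nhds_iff]
  constructor
  · rintro ⟨U, hUs, hU, hX⟩
    obtain ⟨ε, hε, h⟩ := hU X hX
    exact ⟨ε, hε, h.trans hUs⟩
  · rintro ⟨ε, hε, h⟩
    refine ⟨{Y | ∃ δ : ℝ, 0 < δ ∧ measureBall Y δ ⊆ s}, ?_, ?_, ⟨ε, hε, h⟩⟩
    · rintro Y ⟨δ, hδ, hY⟩
      exact hY (self_mem_measureBall Y hδ)
    · rintro Y ⟨δ, hδ, hY⟩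
      refine ⟨δ / 2, by positivity, fun Z hZ => ⟨δ / 2, by positivity, fun W hW => hY ?_⟩⟩
      exact measureBall_triangle hδ hZ hW

/-- Convergence in this topology is convergence in measure. -/
theorem tendsto_iff_tendstoInMeasure {ι : Type*} {l : Filter ι} {Y : ι → Ω →ₘ[P] E}
    {X : Ω →ₘ[P] E} :
    Tendsto Y l (𝓝 X) ↔ TendstoInMeasure P (fun i => (Y i : Ω → E)) l X := by
  rw [tendstoInMeasure_iff_dist]
  constructor
  · intro h ε hε
    rw [ENNReal.tendsto_nhds_zero]
    intro η hη
    obtain ⟨η', hη', hη'η⟩ : ∃ η' : ℝ, 0 < η' ∧ ENNReal.ofReal η' ≤ η := by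
      rcases eq_or_ne η ⊤ with rfl | htop
      · exact ⟨1, one_pos, le_top⟩
      · exact ⟨η.toReal, ENNReal.toReal_pos hη.ne' htop, (ENNReal.ofReal_toReal htop).le⟩
    have hball : measureBall X (min ε η') ∈ 𝓝 X :=
      mem_nhds_iff_measureBall.2 ⟨_, lt_min hε hη', Subset.rfl⟩
    filter_upwards [h hball] with i hi
    calc P {ω | ε ≤ dist (Y i ω) (X ω)}
        ≤ P {ω | min ε η' ≤ dist (Y i ω) (X ω)} :=
          measure_mono fun ω hω => show min ε η' ≤ _ from (min_le_left _ _).trans hω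
      _ ≤ ENNReal.ofReal (min ε η') := le_of_lt hi
      _ ≤ ENNReal.ofReal η' := ENNReal.ofReal_le_ofReal (min_le_right _ _)
      _ ≤ η := hη'η
  · intro h s hs
    obtain ⟨ε, hε, hsub⟩ := mem_nhds_iff_measureBall.1 hs
    have := (h ε hε).eventually (gt_mem_nhds (ENNReal.ofReal_pos.2 hε))
    exact mem_map.2 (by filter_upwards [this] with i hi using hsub hi)

end ConvergenceInMeasure

/-! ### The strict topology on `C_b(E)` -/

section Strict

variable (E : Type*) [TopologicalSpace E]

/-- The bounded (not necessarily continuous) functions on `E` vanishing at infinity: for each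
`ε > 0` there is a compact `K` with `|φ| ≤ ε` off `K`. -/
def BoundedVanishing : Type _ :=
  {φ : E → ℂ // (∃ C : ℝ, ∀ x, ‖φ x‖ ≤ C) ∧
    ∀ ε : ℝ, 0 < ε → ∃ K : Set E, IsCompact K ∧ ∀ x ∉ K, ‖φ x‖ ≤ ε}

instance : Nonempty (BoundedVanishing E) :=
  ⟨⟨0, ⟨0, by simp⟩, fun ε hε => ⟨∅, isCompact_empty, fun x _ => by simpa using hε.le⟩⟩⟩

variable {E}

theorem BoundedVanishing.bddAbove (φ : BoundedVanishing E) (f : E →ᵇ ℂ) :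
    BddAbove (range fun x => ‖φ.1 x * f x‖) := by
  obtain ⟨C, hC⟩ := φ.2.1
  refine ⟨C * ‖f‖, ?_⟩
  rintro _ ⟨x, rfl⟩
  simp only [norm_mul]
  exact mul_le_mul (hC x) (f.norm_coe_le_norm x) (norm_nonneg _) ((norm_nonneg _).trans (hC x))

/-- The seminorm `p_φ(f) = ‖φ f‖_∞` on `C_b(E)`. -/
def strictSeminorm (φ : BoundedVanishing E) : Seminorm ℂ (E →ᵇ ℂ) :=
  Seminorm.of (fun f => ⨆ x, ‖φ.1 x * f x‖)
    (by
      intro f g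
      refine Real.iSup_le (fun x => ?_) (add_nonneg (Real.iSup_nonneg fun x => norm_nonneg _)
        (Real.iSup_nonneg fun x => norm_nonneg _))
      calc ‖φ.1 x * (f + g) x‖ = ‖φ.1 x * f x + φ.1 x * g x‖ := by
            simp [mul_add]
        _ ≤ ‖φ.1 x * f x‖ + ‖φ.1 x * g x‖ := norm_add_le _ _
        _ ≤ _ := add_le_add (le_ciSup (φ.bddAbove f) x) (le_ciSup (φ.bddAbove g) x))
    (by
      intro a f
      rw [Real.mul_iSup_of_nonneg (norm_nonneg a)]
      refine iSup_congr fun x => ?_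
      simp only [BoundedContinuousFunction.coe_smul, smul_eq_mul, norm_mul]
      ring)

variable (E)

/-- The strict topology `β₀` on `C_b(E)`: the locally convex topology generated by the seminorms
`p_φ`, for `φ` bounded and vanishing at infinity. -/
@[reducible]
def strictTopology : TopologicalSpace (E →ᵇ ℂ) :=
  (SeminormFamily.moduleFilterBasis
    (strictSeminorm : SeminormFamily ℂ (E →ᵇ ℂ) (BoundedVanishing E))).topology

end Strict

/-! ### The duality with bounded Radon measures -/

section Duality

variable {E : Type*} [TopologicalSpace E] [MeasurableSpace E]

/-- `μ ∈ M₀(E)`: the complex measure `μ` is a bounded Radon measure, i.e. its total variation is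
finite and inner regular with respect to compact sets on all Borel sets. -/
structure IsBoundedRadon (μ : ComplexMeasure E) : Prop where
  finite : IsFiniteMeasure μ.variation
  innerRegular : μ.variation.InnerRegular

/-- The duality `⟨f, μ⟩ = ∫ f dμ`. -/
def dualPairing (f : E →ᵇ ℂ) (μ : ComplexMeasure E) : ℂ :=
  μ.integral (fun x => f x) (ContinuousLinearMap.mul ℝ ℂ)

variable (E) in
/-- The weak topology `σ = σ(C_b(E), M₀(E))`. -/
@[reducible]
def weakTopologyRadon : TopologicalSpace (E →ᵇ ℂ) :=
  ⨅ μ : {μ : ComplexMeasure E // IsBoundedRadon μ},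
    TopologicalSpace.induced (fun f => dualPairing f μ.1) inferInstance

end Duality

/-! ### Equicontinuity and semigroups of operators -/

section Operators

variable {V : Type*} [AddCommGroup V] [Module ℂ V]

/-- A set `S` of linear operators is `τ`-equicontinuous: its members are `τ`-continuous and for
each `τ`-continuous seminorm `p` there is a `τ`-continuous seminorm `q` with `p (T v) ≤ q v` for
all `v` and all `T ∈ S`. -/
def IsEquicontinuousSet (τ : TopologicalSpace V) (S : Set (V →ₗ[ℂ] V)) : Prop :=
  (∀ T ∈ S, Continuous[τ, τ] T) ∧
    ∀ p : Seminorm ℂ V, Continuous[τ, inferInstance] p →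
      ∃ q : Seminorm ℂ V, Continuous[τ, inferInstance] q ∧ ∀ T ∈ S, ∀ v, p (T v) ≤ q v

/-- The semigroup law: `T(0) = I` and `T(t + s) = T(t) T(s)`. -/
def IsOperatorSemigroup (T : ℝ≥0 → V →ₗ[ℂ] V) : Prop :=
  T 0 = LinearMap.id ∧ ∀ t s, T (t + s) = T t ∘ₗ T s

/-- `τ`-continuity: all orbits are `τ`-continuous. -/
def IsContinuousSemigroup (τ : TopologicalSpace V) (T : ℝ≥0 → V →ₗ[ℂ] V) : Prop :=
  ∀ v, Continuous[inferInstance, τ] fun t => T t v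

/-- Quasi-`τ`-equicontinuity: for some real `α` the operators `e^{-αt} T(t)`, `t ≥ 0`, form a
`τ`-equicontinuous set. -/
def IsQuasiEquicontinuous (τ : TopologicalSpace V) (T : ℝ≥0 → V →ₗ[ℂ] V) : Prop :=
  ∃ α : ℝ, IsEquicontinuousSet τ (range fun t : ℝ≥0 => (Real.exp (-α * t) : ℂ) • T t)

end Operators

/-- `T` is a semigroup on the norming dual pair `(C_b(E), M₀(E))`: a semigroup of `σ`-continuous
operators that is exponentially bounded. -/
structure IsSemigroupOnDualPair {E : Type*} [TopologicalSpace E] [MeasurableSpace E]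
    (T : ℝ≥0 → (E →ᵇ ℂ) →ₗ[ℂ] (E →ᵇ ℂ)) : Prop where
  weak_continuous : ∀ t, Continuous[weakTopologyRadon E, weakTopologyRadon E] (T t)
  semigroup : IsOperatorSemigroup T
  exponentially_bounded : ∃ M ω : ℝ, 1 ≤ M ∧
    ∀ (t : ℝ≥0) (f : E →ᵇ ℂ), ‖T t f‖ ≤ M * Real.exp (ω * t) * ‖f‖

end

/-!
The operators `T(t)` are slices of a single operator `U : C_b(E) → C_b([0, ∞) × E)`,
`U f (t, x) = 𝔼 f(X(t, x))`, where `U f` is continuous because convergence in measure implies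
convergence of expectations of bounded continuous functions. None of the assertions on continuity
and equicontinuity uses the semigroup law.

* *Tightness.* The law of a single strongly measurable map into a complete metric space is tight. If
  `X` is continuous in measure, then a compactness argument and a Cantor-type intersection of closed
  thickenings of compact sets show that the laws of `X(z)`, for `z` in a compact set, are uniformly
  tight (`exists_isCompact_forall_map_compl_le`).

* *Strict continuity of `U`.* Let `Φ` be a weight on the parameter space `Z`, with `‖Φ‖ ≤ 4⁻ⁿ` off a
  compact set `Kₙ`, and choose compact sets `Cₙ` such that `P(X(z) ∉ Cₙ) ≤ 4⁻ⁿ` for `z ∈ Kₙ`. With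
  `w = 1 + ∑ₙ 2ⁿ 𝟙_{E ∖ Cₙ}`, the quantity `‖Φ(z)‖ 𝔼 w(X(z))` is bounded by a constant `M`, so that
  `p_Φ(U f) ≤ p_ψ(f)` for the weight `ψ = M / w`
  (`exists_strictSeminorm_expectationOperator_le`). On `Z = [0, ∞) × E` one takes
  `Φ(t, x) = a(t) φ(x)`: the choice `a = 𝟙_{[0, t₀]}` gives the equicontinuity of the `T(t)`, `t ≤ t₀`,
  and the choice `a(t) = e^{-t}` gives that of all the operators `e^{-t} T(t)`.

* *Orbits.* `U f` is jointly continuous and bounded, hence `t ↦ T(t) f` is continuous uniformly on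
  compact sets and bounded, which is enough for the strict topology
  (`continuous_strictTopology_of_continuous_uncurry`).

* *Weak continuity.* The adjoint of `T(t)` sends a complex measure `μ` to its image under the kernel
  `κ(x, ·)` of laws of `X(t, x)`. The variation of the image is at most `∫ κ(x, ·) d|μ|(x)`, which is
  tight if `|μ|` is, since `κ` is uniformly tight on compact sets. Hence the adjoint preserves bounded
  Radon measures (`isBoundedRadon_kernelImage`), and `T(t)` is weakly continuous.
-/

/-! ### Tightness of the laws of a continuous random field -/

section Tightness

/-- A Cantor-type criterion for compactness. -/
theorem isCompact_iInter_cthickening {E : Type*} [MetricSpace E] [CompleteSpace E] {C : ℕ → Set E}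
    (hC : ∀ n, IsCompact (C n)) {r : ℕ → ℝ} (hr : Tendsto r atTop (𝓝 0)) :
    IsCompact (⋂ n, Metric.cthickening (r n) (C n)) := by
  refine TotallyBounded.isCompact_of_isClosed (Metric.totallyBounded_iff.2 fun ε hε => ?_)
    (isClosed_iInter fun n => Metric.isClosed_cthickening)
  obtain ⟨n, hn⟩ := (hr.eventually (gt_mem_nhds (half_pos hε))).exists
  obtain ⟨t, ht, htC⟩ := Metric.totallyBounded_iff.1 (hC n).totallyBounded _ (half_pos hε)
  refine ⟨t, ht, fun y hy => ?_⟩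
  have hy' := Metric.cthickening_subset_thickening' (half_pos hε) hn (C n) (mem_iInter.1 hy n)
  obtain ⟨c, hc, hyc⟩ := Metric.mem_thickening_iff.1 hy'
  obtain ⟨a, ha, hca⟩ := mem_iUnion₂.1 (htC hc)
  refine mem_iUnion₂.2 ⟨a, ha, Metric.mem_ball.2 ?_⟩
  linarith [dist_triangle y c a, Metric.mem_ball.1 hca]

variable {Ω E Z : Type*} [MeasurableSpace Ω] {P : Measure Ω}
  [MetricSpace E] [MeasurableSpace E] [BorelSpace E]

/-- The law of a strongly measurable map into a complete metric space is tight, although the space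
itself need not be separable: the map has almost surely values in a closed separable subset. -/
theorem exists_isCompact_map_compl_le [CompleteSpace E] [IsFiniteMeasure P] (Y : Ω →ₘ[P] E)
    {ε : ℝ≥0∞} (hε : 0 < ε) : ∃ C : Set E, IsCompact C ∧ P.map Y Cᶜ ≤ ε := by
  obtain ⟨t, ht, htY⟩ := Y.aestronglyMeasurable.isSeparable_ae_range
  have hm : AEMeasurable Y P := Y.aestronglyMeasurable.aemeasurable
  set S : Set E := closure t with hS
  have hScl : IsClosed S := isClosed_closure
  have : CompleteSpace S := hScl.completeSpace_coe
  have : TopologicalSpace.SeparableSpace S := ht.closure.separableSpace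
  have : SecondCountableTopology S := UniformSpace.secondCountable_of_separable S
  have hemb : MeasurableEmbedding (Subtype.val : S → E) :=
    MeasurableEmbedding.subtype_coe hScl.measurableSet
  have hfin : IsFiniteMeasure ((P.map Y).comap (Subtype.val : S → E)) := by
    refine ⟨?_⟩
    rw [hemb.comap_apply]
    exact measure_lt_top _ _
  obtain ⟨K, hK, hKε⟩ := isTightMeasureSet_iff_exists_isCompact_measure_compl_le.1
    (isTightMeasureSet_singleton (μ := (P.map Y).comap (Subtype.val : S → E))) ε hε
  refine ⟨Subtype.val '' K, hK.image continuous_subtype_val, ?_⟩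
  have hsub : (Subtype.val '' K)ᶜ ⊆ Sᶜ ∪ Subtype.val '' Kᶜ := by
    intro y hy
    by_cases hyS : y ∈ S
    · exact Or.inr ⟨⟨y, hyS⟩, fun h => hy ⟨_, h, rfl⟩, rfl⟩
    · exact Or.inl hyS
  have hnull : P.map Y Sᶜ = 0 := by
    rw [Measure.map_apply_of_aemeasurable hm hScl.measurableSet.compl]
    refine measure_mono_null (fun ω hω => ?_) (ae_iff.1 htY)
    exact fun h => hω (subset_closure h)
  calc P.map Y (Subtype.val '' K)ᶜ ≤ P.map Y Sᶜ + P.map Y (Subtype.val '' Kᶜ) :=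
        (measure_mono hsub).trans (measure_union_le _ _)
    _ ≤ ε := by
        rw [hnull, zero_add, ← hemb.comap_apply]
        exact hKε _ rfl

variable [TopologicalSpace Z] {X : Z → (Ω →ₘ[P] E)}

/-- Over a compact parameter set, a random field that is continuous in measure is concentrated, up
to small probability, in a prescribed neighbourhood of a single compact set. -/
theorem exists_isCompact_map_cthickening_compl_le [CompleteSpace E] [IsFiniteMeasure P]
    (hX : Continuous X) {K : Set Z} (hK : IsCompact K) {η r : ℝ} (hη : 0 < η) (hr : 0 < r) :
    ∃ C : Set E, IsCompact C ∧
      ∀ z ∈ K, P.map (X z) (Metric.cthickening r C)ᶜ ≤ ENNReal.ofReal η := by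
  -- The property is local in the parameter: near `z`, the variable `X(z')` is within `r` of `X(z)`
  -- up to probability `η / 2`, and `X(z)` lies in a compact set up to probability `η / 2`.
  refine hK.induction_on (p := fun s => ∃ C : Set E, IsCompact C ∧
      ∀ z ∈ s, P.map (X z) (Metric.cthickening r C)ᶜ ≤ ENNReal.ofReal η)
    ⟨∅, isCompact_empty, by simp⟩ ?_ ?_ ?_
  · rintro s t hst ⟨C, hC, h⟩
    exact ⟨C, hC, fun z hz => h z (hst hz)⟩
  · rintro s t ⟨C, hC, h⟩ ⟨D, hD, h'⟩
    refine ⟨C ∪ D, hC.union hD, ?_⟩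
    rintro z (hz | hz)
    · exact (measure_mono (compl_subset_compl.2
        (Metric.cthickening_subset_of_subset _ subset_union_left))).trans (h z hz)
    · exact (measure_mono (compl_subset_compl.2
        (Metric.cthickening_subset_of_subset _ subset_union_right))).trans (h' z hz)
  · intro z _
    obtain ⟨C, hC, hCη⟩ := exists_isCompact_map_compl_le (X z)
      (ε := ENNReal.ofReal (η / 2)) (by simpa using hη)
    have hδ : 0 < min r (η / 2) := lt_min hr (half_pos hη)
    refine ⟨_, mem_nhdsWithin_of_mem_nhds (hX.continuousAt
      (mem_nhds_iff_measureBall.2 ⟨_, hδ, Subset.rfl⟩)), C, hC, fun z' hz' => ?_⟩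
    have hz'' : P {ω | min r (η / 2) ≤ dist (X z' ω) (X z ω)} <
      ENNReal.ofReal (min r (η / 2)) := hz'
    rw [Measure.map_apply_of_aemeasurable (X z).aestronglyMeasurable.aemeasurable
      hC.isClosed.measurableSet.compl] at hCη
    rw [Measure.map_apply_of_aemeasurable (X z').aestronglyMeasurable.aemeasurable
      Metric.isClosed_cthickening.measurableSet.compl]
    have hsub : X z' ⁻¹' (Metric.cthickening r C)ᶜ ⊆
        X z ⁻¹' Cᶜ ∪ {ω | min r (η / 2) ≤ dist (X z' ω) (X z ω)} := by
      intro ω hω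
      by_contra! hcon
      have h1 : X z ω ∈ C := by
        by_contra h
        exact hcon (Or.inl h)
      have h2 : dist (X z' ω) (X z ω) < min r (η / 2) := by
        by_contra! h
        exact hcon (Or.inr h)
      exact hω (Metric.mem_cthickening_of_dist_le _ _ _ _ h1 (h2.le.trans (min_le_left _ _)))
    calc P (X z' ⁻¹' (Metric.cthickening r C)ᶜ)
        ≤ ENNReal.ofReal (η / 2) + ENNReal.ofReal (η / 2) :=
          (measure_mono hsub).trans ((measure_union_le _ _).trans (add_le_add hCη
            (hz''.le.trans (ENNReal.ofReal_le_ofReal (min_le_right _ _)))))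
      _ = ENNReal.ofReal η := by
          rw [← ENNReal.ofReal_add (by positivity) (by positivity), add_halves]

/-- Over a compact parameter set, the laws of a random field that is continuous in measure are
uniformly tight. -/
theorem exists_isCompact_forall_map_compl_le [CompleteSpace E] [IsFiniteMeasure P]
    (hX : Continuous X) {K : Set Z} (hK : IsCompact K) {ε : ℝ≥0∞} (hε : 0 < ε) :
    ∃ C : Set E, IsCompact C ∧ ∀ z ∈ K, P.map (X z) Cᶜ ≤ ε := by
  obtain ⟨δ, hδ, hδε⟩ := ENNReal.exists_pos_sum_of_countable hε.ne' ℕ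
  choose C hC h using fun n : ℕ => exists_isCompact_map_cthickening_compl_le hX hK
    (NNReal.coe_pos.2 (hδ n)) (Nat.one_div_pos_of_nat (α := ℝ) (n := n))
  refine ⟨_, isCompact_iInter_cthickening hC tendsto_one_div_add_atTop_nhds_zero_nat,
    fun z hz => ?_⟩
  rw [compl_iInter]
  refine (measure_iUnion_le _).trans ((ENNReal.tsum_le_tsum fun n => ?_).trans hδε.le)
  simpa using h n z hz

/-- A finite tight Borel measure on a metric space is a Radon measure. -/
theorem innerRegular_of_tight (m : Measure E) [IsFiniteMeasure m]
    (h : ∀ ε : ℝ≥0∞, 0 < ε → ∃ K : Set E, IsCompact K ∧ m Kᶜ ≤ ε) : m.InnerRegular := by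
  refine ⟨fun U hU r hr => ?_⟩
  obtain ⟨F, hFU, hF, hrF⟩ := hU.exists_lt_isClosed_of_ne_top (measure_ne_top m U) hr
  obtain ⟨K, hK, hKε⟩ := h ((m F - r) / 2)
    (ENNReal.div_pos (tsub_pos_of_lt hrF).ne' ENNReal.ofNat_ne_top)
  refine ⟨F ∩ K, inter_subset_left.trans hFU, hK.inter_left hF, ?_⟩
  by_contra! hle
  have hpos : m F - r ≠ 0 := (tsub_pos_of_lt hrF).ne'
  have htop : m F - r ≠ ⊤ := ENNReal.sub_ne_top (measure_ne_top m F)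
  have h1 : m F ≤ m (F ∩ K) + m Kᶜ := by
    refine (measure_mono fun y hy => ?_).trans (measure_union_le _ _)
    by_cases hyK : y ∈ K
    · exact Or.inl ⟨hy, hyK⟩
    · exact Or.inr hyK
  have h2 : m F < m F := calc
    m F ≤ r + (m F - r) / 2 := h1.trans (add_le_add hle hKε)
    _ < r + (m F - r) := ENNReal.add_lt_add_left hr.ne_top (ENNReal.half_lt_self hpos htop)
    _ = m F := add_tsub_cancel_of_le hrF.le
  exact h2.false

end Tightness

/-! ### The expectation operator of a random field -/

section Expectation

variable {Ω E Z : Type*} [MeasurableSpace Ω] {P : Measure Ω} [MetricSpace E]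

theorem integrable_comp_aeEqFun [IsFiniteMeasure P] (Y : Ω →ₘ[P] E) (f : E →ᵇ ℂ) :
    Integrable (fun ω => f (Y ω)) P :=
  Integrable.of_bound (f.continuous.comp_aestronglyMeasurable Y.aestronglyMeasurable) ‖f‖
    (Eventually.of_forall fun _ => f.norm_coe_le_norm _)

/-- Convergence in measure implies convergence of the expectations of bounded continuous
functions: every sequence has a subsequence converging almost everywhere. -/
theorem tendsto_integral_comp_of_tendsto [IsFiniteMeasure P] {ι : Type*} {l : Filter ι}
    [l.IsCountablyGenerated] {Y : ι → (Ω →ₘ[P] E)} {Y₀ : Ω →ₘ[P] E} (h : Tendsto Y l (𝓝 Y₀))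
    (f : E →ᵇ ℂ) :
    Tendsto (fun i => ∫ ω, f (Y i ω) ∂P) l (𝓝 (∫ ω, f (Y₀ ω) ∂P)) := by
  refine tendsto_of_subseq_tendsto fun u hu => ?_
  obtain ⟨n, -, hn⟩ := (tendsto_iff_tendstoInMeasure.1 (h.comp hu)).exists_seq_tendsto_ae
  refine ⟨n, tendsto_integral_of_dominated_convergence (fun _ => ‖f‖)
    (fun k => (integrable_comp_aeEqFun _ f).aestronglyMeasurable) (integrable_const _)
    (fun k => Eventually.of_forall fun ω => f.norm_coe_le_norm _) ?_⟩
  filter_upwards [hn] with ω hω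
  exact (f.continuous.tendsto _).comp hω

variable [IsProbabilityMeasure P] [TopologicalSpace Z] [FirstCountableTopology Z]

theorem norm_integral_comp_aeEqFun_le (Y : Ω →ₘ[P] E) (f : E →ᵇ ℂ) :
    ‖∫ ω, f (Y ω) ∂P‖ ≤ ‖f‖ := by
  simpa using norm_integral_le_of_norm_le_const (μ := P) (C := ‖f‖)
    (Eventually.of_forall fun ω => f.norm_coe_le_norm (Y ω))

/-- The operator `f ↦ (z ↦ 𝔼 f(X(z)))` from `C_b(E)` to `C_b(Z)` attached to a random field `X`
on `Z` that is continuous in measure. -/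
noncomputable def expectationOperator (X : Z → (Ω →ₘ[P] E)) (hX : Continuous X) :
    (E →ᵇ ℂ) →ₗ[ℂ] (Z →ᵇ ℂ) where
  toFun f := BoundedContinuousFunction.ofNormedAddCommGroup (fun z => ∫ ω, f (X z ω) ∂P)
    (continuous_iff_continuousAt.2 fun _ => tendsto_integral_comp_of_tendsto hX.continuousAt f) ‖f‖
    (fun z => norm_integral_comp_aeEqFun_le (X z) f)
  map_add' f g := by
    ext z
    exact integral_add (integrable_comp_aeEqFun _ f) (integrable_comp_aeEqFun _ g)
  map_smul' c f := by
    ext z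
    exact integral_const_mul c _

@[simp]
theorem expectationOperator_apply (X : Z → (Ω →ₘ[P] E)) (hX : Continuous X) (f : E →ᵇ ℂ) (z : Z) :
    expectationOperator X hX f z = ∫ ω, f (X z ω) ∂P :=
  rfl

theorem norm_expectationOperator_le (X : Z → (Ω →ₘ[P] E)) (hX : Continuous X) (f : E →ᵇ ℂ) :
    ‖expectationOperator X hX f‖ ≤ ‖f‖ :=
  (BoundedContinuousFunction.norm_le (norm_nonneg _)).2 fun z =>
    norm_integral_comp_aeEqFun_le (X z) f

end Expectation

/-! ### Strict continuity of the expectation operator -/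

section StrictBound

/-- The weight `1 + ∑ₙ 2ⁿ 𝟙_{E ∖ Cₙ}` growing off a sequence of compact sets. -/
noncomputable def growthWeight {E : Type*} (C : ℕ → Set E) (y : E) : ℝ≥0∞ :=
  1 + ∑' n, (C n)ᶜ.indicator (fun _ => (2 : ℝ≥0∞) ^ n) y

theorem one_le_growthWeight {E : Type*} (C : ℕ → Set E) (y : E) : 1 ≤ growthWeight C y :=
  le_self_add

theorem two_pow_le_growthWeight {E : Type*} {C : ℕ → Set E} {n : ℕ} {y : E} (hy : y ∉ C n) :
    2 ^ n ≤ growthWeight C y := by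
  calc (2 : ℝ≥0∞) ^ n = (C n)ᶜ.indicator (fun _ => (2 : ℝ≥0∞) ^ n) y := by
        rw [indicator_of_mem (show y ∈ (C n)ᶜ from hy)]
    _ ≤ ∑' n, (C n)ᶜ.indicator (fun _ => (2 : ℝ≥0∞) ^ n) y := ENNReal.le_tsum n
    _ ≤ growthWeight C y := le_add_self

variable {E : Type*} [TopologicalSpace E]

theorem norm_mul_le_strictSeminorm (φ : BoundedVanishing E) (f : E →ᵇ ℂ) (x : E) :
    ‖φ.1 x * f x‖ ≤ strictSeminorm φ f :=
  le_ciSup (φ.bddAbove f) x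

theorem strictSeminorm_le {φ : BoundedVanishing E} {f : E →ᵇ ℂ} {s : ℝ} (hs : 0 ≤ s)
    (h : ∀ x, ‖φ.1 x‖ * ‖f x‖ ≤ s) : strictSeminorm φ f ≤ s :=
  Real.iSup_le (fun x => (norm_mul _ _).trans_le (h x)) hs

/-- The multiple `M / w` of the reciprocal of the growth weight `w` of a sequence of compact sets;
where `w` is infinite, the value is `0`. -/
noncomputable def reciprocalWeight (C : ℕ → Set E) (hC : ∀ n, IsCompact (C n)) (M : ℝ) :
    BoundedVanishing E :=
  ⟨fun y => ((M * ((growthWeight C y)⁻¹).toReal : ℝ) : ℂ), by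
    have key : ∀ (y : E) (n : ℕ), 2 ^ n ≤ growthWeight C y →
        ‖((M * ((growthWeight C y)⁻¹).toReal : ℝ) : ℂ)‖ ≤ |M| * (1 / 2) ^ n := by
      intro y n h
      rw [Complex.norm_real, Real.norm_eq_abs, abs_mul, abs_of_nonneg ENNReal.toReal_nonneg]
      gcongr
      have h1 : (growthWeight C y)⁻¹ ≤ ENNReal.ofReal ((1 / 2) ^ n) := by
        rw [one_div, inv_pow, ENNReal.ofReal_inv_of_pos (by positivity)]
        refine ENNReal.inv_le_inv.2 (le_trans (le_of_eq ?_) h)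
        rw [ENNReal.ofReal_pow (by norm_num), ENNReal.ofReal_ofNat]
      exact ENNReal.toReal_le_of_le_ofReal (by positivity) h1
    refine ⟨⟨|M|, fun y => ?_⟩, fun ε hε => ?_⟩
    · simpa using key y 0 (by simpa using one_le_growthWeight C y)
    · have hlim : Tendsto (fun n : ℕ => |M| * (1 / 2 : ℝ) ^ n) atTop (𝓝 0) := by
        simpa using (tendsto_pow_atTop_nhds_zero_of_lt_one (r := (1 / 2 : ℝ))
          (by norm_num) (by norm_num)).const_mul |M|
      obtain ⟨n, hn⟩ := (hlim.eventually (gt_mem_nhds hε)).exists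
      exact ⟨C n, hC n, fun y hy => (key y n (two_pow_le_growthWeight hy)).trans hn.le⟩⟩

/-- A function is dominated by the growth weight, with constant its reciprocal-weight seminorm.
The strict inequality takes care of the points where the weight is infinite. -/
theorem enorm_le_mul_growthWeight {C : ℕ → Set E} (hC : ∀ n, IsCompact (C n)) {M : ℝ} (hM : 0 < M)
    {f : E →ᵇ ℂ} {s : ℝ} (hs : strictSeminorm (reciprocalWeight C hC M) f < s) (y : E) :
    ‖f y‖ₑ ≤ ENNReal.ofReal (s / M) * growthWeight C y := by
  have hs0 : 0 < s := (apply_nonneg _ _).trans_lt hs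
  have h1 := one_le_growthWeight C y
  rcases eq_or_ne (growthWeight C y) ⊤ with htop | htop
  · rw [htop, ENNReal.mul_top (by simpa using div_pos hs0 hM)]
    exact le_top
  · have hw : 0 < (growthWeight C y).toReal :=
      ENNReal.toReal_pos (zero_lt_one.trans_le h1).ne' htop
    have h2 := (norm_mul_le_strictSeminorm (reciprocalWeight C hC M) f y).trans hs.le
    rw [norm_mul, show ‖(reciprocalWeight C hC M).1 y‖ = M * ((growthWeight C y).toReal)⁻¹ by
      simp [reciprocalWeight, abs_of_pos hM]] at h2
    rw [← ENNReal.ofReal_toReal htop, ← ENNReal.ofReal_mul (by positivity), ← ofReal_norm]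
    refine ENNReal.ofReal_le_ofReal ?_
    calc ‖f y‖ = M * ((growthWeight C y).toReal)⁻¹ * ‖f y‖ * ((growthWeight C y).toReal / M) := by
          field_simp
      _ ≤ s * ((growthWeight C y).toReal / M) := by gcongr
      _ = s / M * (growthWeight C y).toReal := by ring

theorem lintegral_growthWeight [MeasurableSpace E] [OpensMeasurableSpace E] [T2Space E]
    {C : ℕ → Set E} (hC : ∀ n, IsCompact (C n)) (m : Measure E) [IsProbabilityMeasure m] :
    ∫⁻ y, growthWeight C y ∂m = 1 + ∑' n, 2 ^ n * m (C n)ᶜ := by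
  have hmeas : ∀ n, MeasurableSet (C n)ᶜ := fun n => (hC n).measurableSet.compl
  unfold growthWeight
  rw [lintegral_add_left measurable_const,
    lintegral_tsum fun n => (measurable_const.indicator (hmeas n)).aemeasurable]
  simp [lintegral_indicator_const (hmeas _)]

/-- The expectation operator is continuous for the strict topologies, in a quantitative form: a
single weight on `E` controls the seminorm attached to a given weight on the parameter space.
If `‖Φ‖ ≤ 4⁻ⁿ` off `Kₙ`, and the laws of `X(z)` for `z ∈ Kₙ` charge the complement of `Cₙ` with at
most `4⁻ⁿ`, then `‖Φ(z)‖ · 2ⁿ P(X(z) ∉ Cₙ)` is of order `2⁻ⁿ` for every `z`. -/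
theorem exists_strictSeminorm_expectationOperator_le {Ω E Z : Type*} [MeasurableSpace Ω]
    {P : Measure Ω} [IsProbabilityMeasure P] [MetricSpace E] [CompleteSpace E]
    [MeasurableSpace E] [BorelSpace E] [TopologicalSpace Z] [FirstCountableTopology Z]
    (X : Z → (Ω →ₘ[P] E)) (hX : Continuous X) (Φ : BoundedVanishing Z) :
    ∃ ψ : BoundedVanishing E, ∀ f : E →ᵇ ℂ,
      strictSeminorm Φ (expectationOperator X hX f) ≤ strictSeminorm ψ f := by
  obtain ⟨B, hB⟩ := Φ.2.1
  replace hB : ∀ z, ‖Φ.1 z‖ ≤ |B| := fun z => (hB z).trans (le_abs_self B)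
  have h4 : ∀ n : ℕ, (0 : ℝ) < (1 / 4) ^ n := fun n => by positivity
  choose K hK hΦ using fun n : ℕ => Φ.2.2 _ (h4 n)
  choose C hC hCX using fun n : ℕ => exists_isCompact_forall_map_compl_le hX (hK n)
    (ENNReal.ofReal_pos.2 (h4 n))
  set M : ℝ := |B| + 2 * (|B| + 1) with hM
  have hM0 : 0 < M := by positivity
  have hprob : ∀ z, IsProbabilityMeasure (P.map (X z)) := fun z =>
    Measure.isProbabilityMeasure_map (X z).aestronglyMeasurable.aemeasurable
  have hterm : ∀ z n, ‖Φ.1 z‖ₑ * (2 ^ n * P.map (X z) (C n)ᶜ) ≤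
      ENNReal.ofReal (|B| + 1) * ENNReal.ofReal (1 / 2) ^ n := by
    intro z n
    have hprod : ‖Φ.1 z‖ₑ * P.map (X z) (C n)ᶜ ≤
        ENNReal.ofReal (|B| + 1) * ENNReal.ofReal ((1 / 4) ^ n) := by
      by_cases hz : z ∈ K n
      · rw [← ofReal_norm]
        exact mul_le_mul' (ENNReal.ofReal_le_ofReal (by linarith [hB z])) (hCX n z hz)
      · rw [mul_comm (ENNReal.ofReal (|B| + 1)), ← ofReal_norm]
        refine mul_le_mul' (ENNReal.ofReal_le_ofReal (hΦ n z hz)) (prob_le_one.trans ?_)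
        rw [ENNReal.one_le_ofReal]
        linarith [abs_nonneg B]
    calc ‖Φ.1 z‖ₑ * (2 ^ n * P.map (X z) (C n)ᶜ) = 2 ^ n * (‖Φ.1 z‖ₑ * P.map (X z) (C n)ᶜ) := by
          ring
      _ ≤ 2 ^ n * (ENNReal.ofReal (|B| + 1) * ENNReal.ofReal ((1 / 4) ^ n)) := by gcongr
      _ = ENNReal.ofReal (|B| + 1) * ENNReal.ofReal (1 / 2) ^ n := by
          rw [← ENNReal.ofReal_ofNat, ← ENNReal.ofReal_pow (by norm_num),
            ← ENNReal.ofReal_pow (by norm_num), ← ENNReal.ofReal_mul (by positivity),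
            ← ENNReal.ofReal_mul (by positivity), ← ENNReal.ofReal_mul (by positivity)]
          congr 1
          rw [show (1 / 4 : ℝ) = 1 / 2 * (1 / 2) by norm_num, mul_pow, one_div, inv_pow]
          field_simp
  have hweight : ∀ z, ‖Φ.1 z‖ₑ * ∫⁻ y, growthWeight C y ∂(P.map (X z)) ≤ ENNReal.ofReal M := by
    intro z
    rw [lintegral_growthWeight hC, mul_add, mul_one, ← ENNReal.tsum_mul_left, hM,
      ENNReal.ofReal_add (abs_nonneg B) (by positivity)]
    refine add_le_add ?_ ((ENNReal.tsum_le_tsum (hterm z)).trans (le_of_eq ?_))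
    · rw [← ofReal_norm]
      exact ENNReal.ofReal_le_ofReal (hB z)
    · rw [ENNReal.tsum_mul_left, ENNReal.tsum_geometric, mul_comm, ENNReal.ofReal_mul (by norm_num)]
      congr 1
      rw [one_div, ENNReal.ofReal_inv_of_pos two_pos, ENNReal.ofReal_ofNat,
        ENNReal.one_sub_inv_two, inv_inv]
  refine ⟨reciprocalWeight C hC M, fun f => le_of_forall_gt_imp_ge_of_dense fun s hs => ?_⟩
  have hs0 : 0 < s := (apply_nonneg _ _).trans_lt hs
  refine strictSeminorm_le hs0.le fun z => ?_
  rw [← ENNReal.ofReal_le_ofReal_iff hs0.le, ENNReal.ofReal_mul (norm_nonneg _), ofReal_norm,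
    ofReal_norm, expectationOperator_apply]
  have hXm := (X z).aestronglyMeasurable.aemeasurable
  have hwm : Measurable (growthWeight C) := by
    have hind : ∀ n, Measurable ((C n)ᶜ.indicator fun _ => (2 : ℝ≥0∞) ^ n) := fun n =>
      measurable_const.indicator (hC n).measurableSet.compl
    unfold growthWeight
    fun_prop
  calc ‖Φ.1 z‖ₑ * ‖∫ ω, f (X z ω) ∂P‖ₑ
      ≤ ‖Φ.1 z‖ₑ * ∫⁻ ω, ENNReal.ofReal (s / M) * growthWeight C (X z ω) ∂P := by
        gcongr
        exact (enorm_integral_le_lintegral_enorm _).trans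
          (lintegral_mono fun ω => enorm_le_mul_growthWeight hC hM0 hs _)
    _ = ENNReal.ofReal (s / M) * (‖Φ.1 z‖ₑ * ∫⁻ y, growthWeight C y ∂(P.map (X z))) := by
        rw [lintegral_const_mul' _ _ ENNReal.ofReal_ne_top, lintegral_map' hwm.aemeasurable hXm]
        ring
    _ ≤ ENNReal.ofReal (s / M) * ENNReal.ofReal M := by gcongr; exact hweight z
    _ = ENNReal.ofReal s := by
        rw [← ENNReal.ofReal_mul (by positivity), div_mul_cancel₀ _ hM0.ne']

end StrictBound

/-! ### Equicontinuity and strong continuity -/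

section Seminorms

variable {V ι : Type*} [AddCommGroup V] [Module ℂ V] {p : SeminormFamily ℂ V ι}
  {τ : TopologicalSpace V}

/-- A set of operators is equicontinuous as soon as each generating seminorm, composed with the
operators of the set, is dominated by a single generating seminorm. -/
theorem isEquicontinuousSet_of_forall_exists_le (hp : WithSeminorms p) {S : Set (V →ₗ[ℂ] V)}
    (h : ∀ i, ∃ j, ∀ T ∈ S, ∀ v, p i (T v) ≤ p j v) : IsEquicontinuousSet τ S := by
  choose j hj using h
  refine ⟨fun T hT => ?_, fun q hq => ?_⟩
  · refine WithSeminorms.continuous_of_isBounded hp hp T fun i => ⟨{j i}, 1, fun v => ?_⟩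
    simpa using hj i T hT v
  · obtain ⟨s, C, -, hqC⟩ := Seminorm.bound_of_continuous hp q hq
    have : IsTopologicalAddGroup V := hp.topologicalAddGroup
    have : ContinuousSMul ℂ V := hp.continuousSMul
    refine ⟨C • s.sup fun i => p (j i), ?_, fun T hT v => (hqC (T v)).trans ?_⟩
    · exact (Seminorm.continuous_finsetSup fun i _ => hp.continuous_seminorm (j i)).const_smul C
    · simp only [smul_apply]
      refine smul_le_smul_of_nonneg_left ?_ C.2
      refine Seminorm.finset_sup_apply_le (apply_nonneg _ _) fun i hi => (hj i T hT v).trans ?_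
      exact Seminorm.le_finset_sup_apply (p := fun i => p (j i)) hi

theorem continuous_of_forall_seminorm_lt (hp : WithSeminorms p) {S : Type*} [TopologicalSpace S]
    {u : S → V} (h : ∀ s i (ε : ℝ), 0 < ε → ∀ᶠ t in 𝓝 s, p i (u t - u s) < ε) : Continuous u :=
  continuous_iff_continuousAt.2 fun s => (hp.tendsto_nhds u (u s)).2 (h s)

end Seminorms

section StrictOrbits

variable {E : Type*} [TopologicalSpace E]

theorem withSeminorms_strictTopology :
    WithSeminorms (topology := strictTopology E)
      (strictSeminorm : SeminormFamily ℂ (E →ᵇ ℂ) (BoundedVanishing E)) :=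
  WithSeminorms.mk (topology := strictTopology E) rfl

/-- A bounded orbit of a jointly continuous function is continuous for the strict topology: by
compactness the convergence is uniform on compact sets, and off a compact set the weight is
small. -/
theorem continuous_strictTopology_of_continuous_uncurry {S : Type*} [TopologicalSpace S]
    {u : S → (E →ᵇ ℂ)} (hu : Continuous fun a : S × E => u a.1 a.2) {R : ℝ}
    (hR : ∀ s, ‖u s‖ ≤ R) : Continuous[inferInstance, strictTopology E] u := by
  refine continuous_of_forall_seminorm_lt withSeminorms_strictTopology fun s φ ε hε => ?_
  obtain ⟨B, hB⟩ := φ.2.1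
  have hR0 : 0 ≤ R := (norm_nonneg _).trans (hR s)
  obtain ⟨K, hK, hφK⟩ := φ.2.2 (ε / (4 * (R + 1))) (by positivity)
  have hunif : ∀ᶠ t in 𝓝 s, ∀ x ∈ K, dist (u t x) (u s x) < ε / (2 * (|B| + 1)) := by
    refine hK.eventually_forall_of_forall_eventually fun x _ => ?_
    have h1 : ContinuousAt (fun a : S × E => dist (u a.1 a.2) (u s a.2)) (s, x) :=
      (hu.dist ((u s).continuous.comp continuous_snd)).continuousAt
    refine h1.eventually_lt continuousAt_const ?_
    rw [dist_self]
    positivity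
  filter_upwards [hunif] with t ht
  refine lt_of_le_of_lt (strictSeminorm_le (s := ε / 2) (by positivity) fun x => ?_)
    (half_lt_self hε)
  by_cases hx : x ∈ K
  · calc ‖φ.1 x‖ * ‖(u t - u s) x‖ ≤ |B| * (ε / (2 * (|B| + 1))) := by
          refine mul_le_mul ((hB x).trans (le_abs_self B)) ?_ (norm_nonneg _) (abs_nonneg B)
          rw [BoundedContinuousFunction.sub_apply, ← dist_eq_norm]
          exact (ht x hx).le
      _ ≤ (|B| + 1) * (ε / (2 * (|B| + 1))) := by gcongr; linarith
      _ = ε / 2 := by field_simp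
  · calc ‖φ.1 x‖ * ‖(u t - u s) x‖ ≤ ε / (4 * (R + 1)) * (R + R) := by
          refine mul_le_mul (hφK x hx) ?_ (norm_nonneg _) (by positivity)
          exact ((u t - u s).norm_coe_le_norm x).trans
            ((norm_sub_le _ _).trans (add_le_add (hR t) (hR s)))
      _ ≤ ε / (4 * (R + 1)) * (2 * (R + 1)) := by gcongr; linarith
      _ = ε / 2 := by field_simp; norm_num

/-- The product of a scalar function vanishing at infinity on the parameter space with a weight
on `E`, as a weight on the product space. -/
noncomputable def BoundedVanishing.prod {S : Type*} [TopologicalSpace S] (a : BoundedVanishing S)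
    (φ : BoundedVanishing E) : BoundedVanishing (S × E) :=
  ⟨fun z => a.1 z.1 * φ.1 z.2, by
    obtain ⟨A, hA⟩ := a.2.1
    obtain ⟨B, hB⟩ := φ.2.1
    replace hA : ∀ s, ‖a.1 s‖ ≤ |A| := fun s => (hA s).trans (le_abs_self A)
    replace hB : ∀ x, ‖φ.1 x‖ ≤ |B| := fun x => (hB x).trans (le_abs_self B)
    refine ⟨⟨|A| * |B|, fun z => ?_⟩, fun ε hε => ?_⟩
    · rw [norm_mul]
      exact mul_le_mul (hA _) (hB _) (norm_nonneg _) (abs_nonneg _)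
    · obtain ⟨K, hK, hK'⟩ := a.2.2 (ε / (|B| + 1)) (by positivity)
      obtain ⟨L, hL, hL'⟩ := φ.2.2 (ε / (|A| + 1)) (by positivity)
      refine ⟨K ×ˢ L, hK.prod hL, fun z hz => ?_⟩
      rw [norm_mul]
      by_cases h : z.1 ∈ K
      · have h' : z.2 ∉ L := fun h' => hz ⟨h, h'⟩
        calc ‖a.1 z.1‖ * ‖φ.1 z.2‖ ≤ (|A| + 1) * (ε / (|A| + 1)) :=
              mul_le_mul (by linarith [hA z.1]) (hL' _ h') (norm_nonneg _) (by positivity)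
          _ = ε := by field_simp
      · calc ‖a.1 z.1‖ * ‖φ.1 z.2‖ ≤ ε / (|B| + 1) * (|B| + 1) :=
              mul_le_mul (hK' _ h) (by linarith [hB z.2]) (norm_nonneg _) (by positivity)
          _ = ε := by field_simp⟩

/-- The indicator function of a compact set. -/
noncomputable def BoundedVanishing.indicator {S : Type*} [TopologicalSpace S] {K : Set S}
    (hK : IsCompact K) : BoundedVanishing S :=
  ⟨K.indicator fun _ => 1,
    ⟨1, fun s => (norm_indicator_le_norm_self _ s).trans (by simp)⟩,
    fun ε hε => ⟨K, hK, fun s hs => by simpa [hs] using hε.le⟩⟩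

/-- The function `t ↦ e^{-t}` on `[0, ∞)`. -/
noncomputable def BoundedVanishing.expNeg : BoundedVanishing ℝ≥0 :=
  ⟨fun t => ((Real.exp (-t) : ℝ) : ℂ), by
    have hnorm : ∀ t : ℝ≥0, ‖((Real.exp (-t) : ℝ) : ℂ)‖ = Real.exp (-t) := fun t => by
      rw [Complex.norm_real, Real.norm_of_nonneg (Real.exp_pos _).le]
    refine ⟨⟨1, fun t => ?_⟩, fun ε hε => ?_⟩
    · rw [hnorm]
      exact Real.exp_le_one_iff.2 (neg_nonpos.2 t.2)
    · refine ⟨Icc 0 (-Real.log ε).toNNReal, isCompact_Icc, fun t ht => ?_⟩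
      rw [hnorm, ← Real.le_log_iff_exp_le hε]
      have h : -Real.log ε < t := by
        by_contra! h
        exact ht ⟨zero_le, NNReal.coe_le_coe.1 (h.trans (Real.le_coe_toNNReal _))⟩
      linarith⟩

end StrictOrbits

/-! ### Images of complex measures under Markov kernels -/

section KernelImage

open ProbabilityTheory

variable {Z E : Type*} [MeasurableSpace Z] [MeasurableSpace E]

/-- Complex homogeneity of the integral against a complex measure, for which the pairing is only
bilinear over `ℝ`. -/
theorem integral_mul_const_mul (μ : ComplexMeasure Z) (c : ℂ) {g : Z → ℂ}
    (hg : Integrable g μ.variation) :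
    μ.integral (fun z => c * g z) (ContinuousLinearMap.mul ℝ ℂ) =
      c * μ.integral g (ContinuousLinearMap.mul ℝ ℂ) := by
  have h1 := VectorMeasure.integral_continuousLinearMap_comp (μ := μ)
    (B := ContinuousLinearMap.mul ℝ ℂ) (C := ContinuousLinearMap.mul ℝ ℂ c) hg
  have h2 := VectorMeasure.continuousLinearMap_apply_integral (μ := μ)
    (B := ContinuousLinearMap.mul ℝ ℂ) (C := ContinuousLinearMap.mul ℝ ℂ c) hg
  simp only [ContinuousLinearMap.mul_apply'] at h1 h2
  rw [h1, h2]
  congr 1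
  ext
  simp [mul_assoc]

theorem stronglyMeasurable_kernel_real (κ : Kernel Z E) {s : Set E} (hs : MeasurableSet s) :
    StronglyMeasurable fun z => ((κ z).real s : ℂ) :=
  (Complex.measurable_ofReal.comp (κ.measurable_coe hs).ennreal_toReal).stronglyMeasurable

variable (κ : Kernel Z E) [IsMarkovKernel κ] (μ : ComplexMeasure Z)

variable [IsFiniteMeasure μ.variation]

theorem integrable_kernel_real {s : Set E} (hs : MeasurableSet s) :
    Integrable (fun z => ((κ z).real s : ℂ)) μ.variation :=
  Integrable.of_bound (stronglyMeasurable_kernel_real κ hs).aestronglyMeasurable 1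
    (Eventually.of_forall fun z => by
      rw [Complex.norm_real, Real.norm_of_nonneg measureReal_nonneg]
      exact measureReal_le_one)

/-- The image of a complex measure `μ` of finite variation under a Markov kernel `κ`, the complex
measure `s ↦ ∫ κ(z, s) dμ(z)`. -/
noncomputable def kernelImage : ComplexMeasure E where
  measureOf' s := open Classical in if MeasurableSet s then
    μ.integral (fun z => ((κ z).real s : ℂ)) (ContinuousLinearMap.mul ℝ ℂ) else 0
  empty' := by simp
  not_measurable' s hs := by simp [hs]
  m_iUnion' s hs hd := by
    have hsum : ∀ z, HasSum (fun i => (κ z).real (s i)) ((κ z).real (⋃ i, s i)) := fun z => by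
      have h := ENNReal.hasSum_toReal (f := fun i => κ z (s i))
        (by rw [← measure_iUnion hd hs]; exact measure_ne_top _ _)
      rwa [← ENNReal.tsum_toReal_eq fun i => measure_ne_top _ _, ← measure_iUnion hd hs] at h
    simp only [hs, MeasurableSet.iUnion hs, if_true]
    refine VectorMeasure.hasSum_integral_of_dominated_convergence
      (fun i z => (κ z).real (s i))
      (fun i => (stronglyMeasurable_kernel_real κ (hs i)).aestronglyMeasurable)
      (fun i => Eventually.of_forall fun z => ?_)
      (Eventually.of_forall fun z => (hsum z).summable) ?_
      (Eventually.of_forall fun z => Complex.hasSum_ofReal.2 (hsum z))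
    · rw [Complex.norm_real, Real.norm_of_nonneg measureReal_nonneg]
    · simp only [(hsum _).tsum_eq]
      simpa using (integrable_kernel_real κ μ (MeasurableSet.iUnion hs)).re

theorem kernelImage_apply {s : Set E} (hs : MeasurableSet s) :
    kernelImage κ μ s =
      μ.integral (fun z => ((κ z).real s : ℂ)) (ContinuousLinearMap.mul ℝ ℂ) :=
  if_pos hs

theorem variation_kernelImage_le : (kernelImage κ μ).variation ≤ μ.variation.bind κ := by
  refine VectorMeasure.variation_le_of_forall_enorm_le fun s hs => ?_
  rw [kernelImage_apply κ μ hs, Measure.bind_apply hs κ.aemeasurable]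
  refine VectorMeasure.enorm_integral_le_lintegral_enorm.trans ?_
  have hB : ‖ContinuousLinearMap.mul ℝ ℂ‖ₑ ≤ 1 := by
    rw [← ofReal_norm, ENNReal.ofReal_le_one]
    exact ContinuousLinearMap.opNorm_mul_le ℝ ℂ
  refine (mul_le_mul_left hB _).trans ?_
  rw [one_mul]
  refine lintegral_mono fun z => ?_
  rw [← ofReal_norm, Complex.norm_real, Real.norm_of_nonneg measureReal_nonneg,
    ofReal_measureReal]

instance : IsFiniteMeasure (kernelImage κ μ).variation :=
  isFiniteMeasure_of_le _ (variation_kernelImage_le κ μ)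

theorem integrable_integral_kernel {f : E → ℂ} (hf : StronglyMeasurable f) {C : ℝ}
    (hC : ∀ y, ‖f y‖ ≤ C) : Integrable (fun z => ∫ y, f y ∂κ z) μ.variation :=
  Integrable.of_bound (hf.integral_kernel (κ := κ)).aestronglyMeasurable C
    (Eventually.of_forall fun z => by
      simpa using norm_integral_le_of_norm_le_const (μ := κ z) (Eventually.of_forall hC))

theorem integral_kernelImage_simpleFunc (g : SimpleFunc E ℂ) :
    (kernelImage κ μ).integral g (ContinuousLinearMap.mul ℝ ℂ) =
      μ.integral (fun z => ∫ y, g y ∂κ z) (ContinuousLinearMap.mul ℝ ℂ) := by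
  induction g using SimpleFunc.induction with
  | const c hs =>
    rename_i s
    have hκc : ∀ z, ∫ y, s.indicator (fun _ => c) y ∂κ z = c * ((κ z).real s : ℂ) := fun z => by
      rw [integral_indicator_const _ hs, Complex.real_smul, mul_comm]
    simp only [SimpleFunc.coe_piecewise, SimpleFunc.coe_const, SimpleFunc.const_zero,
      SimpleFunc.coe_zero, piecewise_eq_indicator]
    rw [show Function.const E c = fun _ => c from rfl]
    simp only [hκc]
    rw [integral_mul_const_mul μ c (integrable_kernel_real κ μ hs), ← kernelImage_apply κ μ hs]
    exact VectorMeasure.integral_indicator_const _ hs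
  | add _ ih₁ ih₂ =>
    rename_i g₁ g₂ _
    have hi : ∀ g : SimpleFunc E ℂ, ∀ z, Integrable g (κ z) := fun g z =>
      SimpleFunc.integrable_of_isFiniteMeasure g
    have hint : ∀ g : SimpleFunc E ℂ, Integrable (fun z => ∫ y, g y ∂κ z) μ.variation := fun g =>
      (g.exists_forall_norm_le).elim fun _ hR =>
        integrable_integral_kernel κ μ g.stronglyMeasurable hR
    have hadd : (fun z => ∫ y, (g₁ + g₂) y ∂κ z) =
        fun z => ∫ y, g₁ y ∂κ z + ∫ y, g₂ y ∂κ z := funext fun z => by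
      simpa using integral_add (hi g₁ z) (hi g₂ z)
    rw [hadd, VectorMeasure.integral_fun_add (hint g₁) (hint g₂), ← ih₁, ← ih₂]
    exact VectorMeasure.integral_add (SimpleFunc.integrable_of_isFiniteMeasure g₁)
      (SimpleFunc.integrable_of_isFiniteMeasure g₂)

/-- The change of variables formula `∫ f d(κμ) = ∫ (∫ f(y) κ(z, dy)) dμ(z)`, by approximation of
`f` with simple functions. -/
theorem integral_kernelImage {f : E → ℂ} (hf : StronglyMeasurable f) {C : ℝ}
    (hC : ∀ y, ‖f y‖ ≤ C) :
    (kernelImage κ μ).integral f (ContinuousLinearMap.mul ℝ ℂ) =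
      μ.integral (fun z => ∫ y, f y ∂κ z) (ContinuousLinearMap.mul ℝ ℂ) := by
  have hC' : ∀ n y, ‖hf.approxBounded |C| n y‖ ≤ |C| :=
    fun n y => hf.norm_approxBounded_le (abs_nonneg C) n y
  have hlim : ∀ y, Tendsto (fun n => hf.approxBounded |C| n y) atTop (𝓝 (f y)) := fun y =>
    hf.tendsto_approxBounded_of_norm_le ((hC y).trans (le_abs_self C))
  have h1 : Tendsto (fun n => (kernelImage κ μ).integral (fun y => hf.approxBounded |C| n y)
      (ContinuousLinearMap.mul ℝ ℂ)) atTop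
      (𝓝 ((kernelImage κ μ).integral f (ContinuousLinearMap.mul ℝ ℂ))) :=
    VectorMeasure.tendsto_integral_filter_of_norm_le_const
      (Eventually.of_forall fun n => (SimpleFunc.stronglyMeasurable _).aestronglyMeasurable)
      ⟨|C|, Eventually.of_forall fun n => Eventually.of_forall (hC' n)⟩
      (Eventually.of_forall hlim)
  have h2 : Tendsto (fun n => μ.integral (fun z => ∫ y, hf.approxBounded |C| n y ∂κ z)
      (ContinuousLinearMap.mul ℝ ℂ)) atTop
      (𝓝 (μ.integral (fun z => ∫ y, f y ∂κ z) (ContinuousLinearMap.mul ℝ ℂ))) :=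
    VectorMeasure.tendsto_integral_filter_of_norm_le_const
      (Eventually.of_forall fun n => (integrable_integral_kernel κ μ
        (SimpleFunc.stronglyMeasurable _) (hC' n)).aestronglyMeasurable)
      ⟨|C|, Eventually.of_forall fun n => Eventually.of_forall fun z => by
        simpa using norm_integral_le_of_norm_le_const (μ := κ z) (Eventually.of_forall (hC' n))⟩
      (Eventually.of_forall fun z => tendsto_integral_of_dominated_convergence (fun _ => |C|)
        (fun n => (SimpleFunc.stronglyMeasurable _).aestronglyMeasurable) (integrable_const _)
        (fun n => Eventually.of_forall (hC' n)) (Eventually.of_forall hlim))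
  refine tendsto_nhds_unique h1 (h2.congr fun n => ?_)
  exact (integral_kernelImage_simpleFunc κ μ _).symm

end KernelImage

/-! ### Weak continuity of the expectation operator -/

section Weak

open ProbabilityTheory

variable {Ω E Z : Type*} [MeasurableSpace Ω] {P : Measure Ω} [IsProbabilityMeasure P]
  [MetricSpace E] [MeasurableSpace E] [BorelSpace E] [TopologicalSpace Z]
  [FirstCountableTopology Z] [MeasurableSpace Z] [OpensMeasurableSpace Z]

/-- The laws of a random field that is continuous in measure depend measurably on the parameter:
the mass of a closed set is a limit of expectations of continuous functions. -/
theorem measurable_map_of_continuous {X : Z → (Ω →ₘ[P] E)} (hX : Continuous X) :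
    Measurable fun z => P.map (X z) := by
  have hXm : ∀ z, AEMeasurable (X z) P := fun z => (X z).aestronglyMeasurable.aemeasurable
  have hprob : ∀ z, IsProbabilityMeasure (P.map (X z)) := fun z =>
    Measure.isProbabilityMeasure_map (hXm z)
  refine Measurable.measure_of_isPiSystem_of_isProbabilityMeasure
    (‹BorelSpace E›.measurable_eq.trans borel_eq_generateFrom_isClosed) isPiSystem_isClosed
    fun F hF => ?_
  refine measurable_of_tendsto_metrizable (f := fun n z => ∫⁻ y, (hF.apprSeq n y : ℝ≥0∞)
    ∂(P.map (X z))) (fun n => ?_) (tendsto_pi_nhds.2 fun z =>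
      HasOuterApproxClosed.tendsto_lintegral_apprSeq hF _)
  let g : E →ᵇ ℂ := BoundedContinuousFunction.ofNormedAddCommGroup
    (fun y => ((hF.apprSeq n y : ℝ) : ℂ)) (by fun_prop) 1
    (fun y => by simpa using HasOuterApproxClosed.apprSeq_apply_le_one hF n y)
  have heq : ∀ z, ∫⁻ y, (hF.apprSeq n y : ℝ≥0∞) ∂(P.map (X z)) =
      ENNReal.ofReal (expectationOperator X hX g z).re := by
    intro z
    rw [lintegral_map' (by fun_prop) (hXm z), lintegral_coe_eq_integral]
    · congr 1
      rw [expectationOperator_apply]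
      exact (congrArg Complex.re (integral_ofReal (𝕜 := ℂ)
        (f := fun ω => (hF.apprSeq n (X z ω) : ℝ)))).symm
    · simpa [g] using (integrable_comp_aeEqFun (X z) g).re
  simp only [heq]
  fun_prop

/-- The Markov kernel of the laws of a random field. -/
noncomputable def lawKernel (X : Z → (Ω →ₘ[P] E)) (hX : Continuous X) : Kernel Z E :=
  ⟨fun z => P.map (X z), measurable_map_of_continuous hX⟩

theorem lawKernel_apply (X : Z → (Ω →ₘ[P] E)) (hX : Continuous X) (z : Z) :
    lawKernel X hX z = P.map (X z) :=
  rfl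

instance (X : Z → (Ω →ₘ[P] E)) (hX : Continuous X) : IsMarkovKernel (lawKernel X hX) :=
  ⟨fun z => Measure.isProbabilityMeasure_map (X z).aestronglyMeasurable.aemeasurable⟩

/-- The adjoint of the expectation operator maps complex measures to their images under the kernel
of laws. -/
theorem dualPairing_expectationOperator (X : Z → (Ω →ₘ[P] E)) (hX : Continuous X)
    (μ : ComplexMeasure Z) [IsFiniteMeasure μ.variation] (f : E →ᵇ ℂ) :
    dualPairing (expectationOperator X hX f) μ =
      dualPairing f (kernelImage (lawKernel X hX) μ) := by
  unfold dualPairing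
  rw [integral_kernelImage _ _ f.continuous.measurable.stronglyMeasurable f.norm_coe_le_norm]
  congr 1
  ext z
  rw [lawKernel_apply, integral_map (X z).aestronglyMeasurable.aemeasurable
    f.continuous.measurable.stronglyMeasurable.aestronglyMeasurable, expectationOperator_apply]

/-- The kernel of laws maps bounded Radon measures to bounded Radon measures, since it is uniformly
tight over compact sets. -/
theorem isBoundedRadon_kernelImage [CompleteSpace E] [T2Space Z] (X : Z → (Ω →ₘ[P] E))
    (hX : Continuous X) {μ : ComplexMeasure Z} (hμ : IsBoundedRadon μ)
    [IsFiniteMeasure μ.variation] :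
    IsBoundedRadon (kernelImage (lawKernel X hX) μ) := by
  refine ⟨inferInstance, innerRegular_of_tight _ fun ε hε => ?_⟩
  have := hμ.innerRegular
  -- The mass off `C` splits into the part coming from `K`, where the kernel gives `C` almost all of
  -- its mass, and the part coming from the complement of `K`, which has small variation; `V + 1`
  -- is used in place of `V` to have a nonzero divisor.
  set V : ℝ≥0∞ := μ.variation univ
  have hV : V ≠ ⊤ := measure_ne_top _ _
  obtain ⟨K, hK, hKε⟩ := isTightMeasureSet_iff_exists_isCompact_measure_compl_le.1
    (isTightMeasureSet_singleton_of_innerRegular (μ := μ.variation)) (ε / 2)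
    (ENNReal.half_pos hε.ne')
  obtain ⟨C, hC, hCX⟩ := exists_isCompact_forall_map_compl_le hX hK
    (ε := ε / 2 / (V + 1)) (ENNReal.div_pos (ENNReal.half_pos hε.ne').ne' (by simp [hV]))
  refine ⟨C, hC, (variation_kernelImage_le _ μ _).trans ?_⟩
  rw [Measure.bind_apply hC.measurableSet.compl (Kernel.aemeasurable _),
    ← lintegral_add_compl _ hK.measurableSet]
  calc ∫⁻ z in K, lawKernel X hX z Cᶜ ∂μ.variation + ∫⁻ z in Kᶜ, lawKernel X hX z Cᶜ ∂μ.variation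
      ≤ ∫⁻ _ in K, ε / 2 / (V + 1) ∂μ.variation + ∫⁻ _ in Kᶜ, 1 ∂μ.variation :=
        add_le_add (setLIntegral_mono measurable_const hCX)
          (lintegral_mono fun z => prob_le_one)
    _ ≤ ε / 2 / (V + 1) * (V + 1) + ε / 2 := by
        rw [setLIntegral_const, setLIntegral_const, one_mul]
        gcongr
        · exact (measure_mono (subset_univ K)).trans le_self_add
        · exact hKε _ rfl
    _ ≤ ε := by
        rw [ENNReal.div_mul_cancel (by simp) (by simp [hV]), ENNReal.add_halves]

theorem continuous_weakTopologyRadon_expectationOperator [CompleteSpace E] [T2Space Z]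
    (X : Z → (Ω →ₘ[P] E)) (hX : Continuous X) :
    Continuous[weakTopologyRadon E, weakTopologyRadon Z] (expectationOperator X hX) := by
  refine continuous_iInf_rng.2 fun μ => continuous_induced_rng.2 ?_
  have := μ.2.finite
  have h : Continuous[weakTopologyRadon E, inferInstance]
      fun f => dualPairing f (kernelImage (lawKernel X hX) μ.1) :=
    continuous_iInf_dom (i := ⟨_, isBoundedRadon_kernelImage X hX μ.2⟩) continuous_induced_dom
  have heq : (fun g => dualPairing g μ.1) ∘ expectationOperator X hX =
      fun f => dualPairing f (kernelImage (lawKernel X hX) μ.1) :=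
    funext fun f => dualPairing_expectationOperator X hX μ.1 f
  rw [heq]
  exact h

end Weak

/-! ### The operators of a random field indexed by time and space -/

section Slices

variable {Ω E : Type*} [MeasurableSpace Ω] {P : Measure Ω} [IsProbabilityMeasure P]
  [MetricSpace E] (X : ℝ≥0 × E → (Ω →ₘ[P] E)) (hX : Continuous X)

/-- The operator `T(t)f(x) = 𝔼 f(X(t, x))`. -/
noncomputable def sliceOperator (t : ℝ≥0) : (E →ᵇ ℂ) →ₗ[ℂ] (E →ᵇ ℂ) :=
  expectationOperator (fun x => X (t, x)) (hX.comp (Continuous.prodMk_right t))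

theorem sliceOperator_apply (t : ℝ≥0) (f : E →ᵇ ℂ) (x : E) :
    sliceOperator X hX t f x = expectationOperator X hX f (t, x) :=
  rfl

theorem isContinuousSemigroup_sliceOperator :
    IsContinuousSemigroup (strictTopology E) (sliceOperator X hX) := fun f =>
  continuous_strictTopology_of_continuous_uncurry (expectationOperator X hX f).continuous
    fun _ => norm_expectationOperator_le _ _ f

variable [CompleteSpace E] [MeasurableSpace E] [BorelSpace E]

/-- If `a` vanishes at infinity on `[0, ∞)`, then the operators `a(t) T(t)` are controlled
uniformly in `t`. -/
theorem exists_forall_strictSeminorm_smul_sliceOperator_le (a : BoundedVanishing ℝ≥0)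
    (φ : BoundedVanishing E) : ∃ ψ : BoundedVanishing E, ∀ (t : ℝ≥0) (f : E →ᵇ ℂ),
      strictSeminorm φ (a.1 t • sliceOperator X hX t f) ≤ strictSeminorm ψ f := by
  obtain ⟨ψ, hψ⟩ := exists_strictSeminorm_expectationOperator_le X hX (a.prod φ)
  refine ⟨ψ, fun t f => (strictSeminorm_le (apply_nonneg _ _) fun x => ?_).trans (hψ f)⟩
  refine le_trans (le_of_eq ?_) (norm_mul_le_strictSeminorm (a.prod φ) _ (t, x))
  simp only [BoundedVanishing.prod, BoundedContinuousFunction.coe_smul, smul_eq_mul, norm_mul,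
    sliceOperator_apply]
  ring

theorem isEquicontinuousSet_sliceOperator (t₀ : ℝ≥0) :
    IsEquicontinuousSet (strictTopology E) {S | ∃ t ≤ t₀, S = sliceOperator X hX t} := by
  refine isEquicontinuousSet_of_forall_exists_le withSeminorms_strictTopology fun φ => ?_
  obtain ⟨ψ, hψ⟩ := exists_forall_strictSeminorm_smul_sliceOperator_le X hX
    (BoundedVanishing.indicator (isCompact_Icc (a := 0) (b := t₀))) φ
  refine ⟨ψ, ?_⟩
  rintro _ ⟨t, ht, rfl⟩ f
  simpa [BoundedVanishing.indicator, ht] using hψ t f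

theorem isQuasiEquicontinuous_sliceOperator :
    IsQuasiEquicontinuous (strictTopology E) (sliceOperator X hX) := by
  refine ⟨1, isEquicontinuousSet_of_forall_exists_le withSeminorms_strictTopology fun φ => ?_⟩
  obtain ⟨ψ, hψ⟩ := exists_forall_strictSeminorm_smul_sliceOperator_le X hX
    BoundedVanishing.expNeg φ
  refine ⟨ψ, ?_⟩
  rintro _ ⟨t, rfl⟩ f
  simpa [BoundedVanishing.expNeg] using hψ t f

end Slices

theorem mainTheorem2 {Ω : Type*} [MeasurableSpace Ω] (P : Measure Ω) [IsProbabilityMeasure P]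
    {E : Type*} [MetricSpace E] [CompleteSpace E] [MeasurableSpace E] [BorelSpace E]
    (X : ℝ≥0 × E → (Ω →ₘ[P] E)) (hX : Continuous X) :
    ∃ T : ℝ≥0 → (E →ᵇ ℂ) →ₗ[ℂ] (E →ᵇ ℂ),
      (∀ (t : ℝ≥0) (f : E →ᵇ ℂ) (x : E),
        MeasureTheory.Integrable (fun ω => f (X (t, x) ω)) P ∧
          T t f x = ∫ ω, f (X (t, x) ω) ∂P) ∧
      (∀ t, Continuous[weakTopologyRadon E, weakTopologyRadon E] (T t)) ∧
      (∀ t₀ : ℝ≥0, 0 < t₀ → IsEquicontinuousSet (strictTopology E) {S | ∃ t ≤ t₀, S = T t}) ∧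
      (IsOperatorSemigroup T →
        IsSemigroupOnDualPair T ∧
        IsContinuousSemigroup (strictTopology E) T ∧
        IsQuasiEquicontinuous (strictTopology E) T) := by
  have hweak : ∀ t, Continuous[weakTopologyRadon E, weakTopologyRadon E] (sliceOperator X hX t) :=
    fun t => continuous_weakTopologyRadon_expectationOperator _ _
  -- The operators are contractions, so they are exponentially bounded with `M = 1` and `ω = 0`.
  refine ⟨sliceOperator X hX, fun t f x => ⟨integrable_comp_aeEqFun _ f, rfl⟩, hweak,
    fun t₀ _ => isEquicontinuousSet_sliceOperator X hX t₀, fun hT => ⟨⟨hweak, hT, 1, 0, le_rfl,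
      fun t f => ?_⟩, isContinuousSemigroup_sliceOperator X hX,
      isQuasiEquicontinuous_sliceOperator X hX⟩⟩
  simpa using! norm_expectationOperator_le (fun x => X (t, x)) _ f
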